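/- Let $$A=\frac{4\pi^7-7680}{15\pi^9},\qquad B=\frac{23}{1890},\qquad \varphi_p(x)=-\cos x+\left(\frac{\sin x}{x}\right)^3-\frac1{15}x^4+p\,x^6\quad\bigl(x\in(0,\pi/2),\ p>0\bigr).$$ For every $p\in(A,B)$ the function $\varphi_p$ has exactly one local extremum $t^{(p)}$ on $(0,\pi/2)$, it is the point where $\varphi_p$ attains its minimum over $(0,\pi/2)$, and the limit $\varphi_p(\frac{\pi}{2}-)=\lim_{x\to\pi/2-}\varphi_p(x)$ exists and is finite. Moreover: (iv) There is exactly one $p_0\in(A,B)$ with $$\bigl|\varphi_{p_0}(t^{(p_0)})\bigr|=\varphi_{p_0}\left(\tfrac{\pi}{2}-\right),$$ and $p_0=0.010004\dots$, that is, $0.010004\le p_0<0.010005$. The value $d_0=\bigl|\varphi_{p_0}(t^{(p_0)})\bigr|=\varphi_{p_0}(\frac{\pi}{2}-)$ is $0.0024209\dots$, that is, $0.0024209\le d_0<0.0024210$, and $$d_0=\inf_{p>0}\ \sup_{x\in(0,\pi/2)}|\varphi_p(x)|.$$ (v) $\varphi_{p_0}$ is the minimax approximant of the family on $(0,\pi/2)$: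 $p_0$ is the unique $p>0$ for which $\sup_{x\in(0,\pi/2)}|\varphi_p(x)|$ attains this infimum. It determines the approximation $\cos x-\left(\frac{\sin x}{x}\right)^3\approx-\frac1{15}x^4+p_0x^6$, whose absolute error is at most $d_0$ for every $x\in(0,\pi/2)$. -/

import Mathlib

open Set Filter Topology

noncomputable section

/-- The error `d^(p) = sup_{x ∈ (a,b)} |φ_p(x)|` of the member `φ p` of a family, taken in the
extended reals, so that an unbounded function has error `⊤`. -/
def familyError (φ : ℝ → ℝ → ℝ) (a b p : ℝ) : EReal :=
  ⨆ x ∈ Ioo a b, ((|φ p x| : ℝ) : EReal)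

/-- `d₀ = inf_{p ∈ ℝ⁺} sup_{x ∈ (a,b)} |φ_p(x)|`. -/
def minimaxError (φ : ℝ → ℝ → ℝ) (a b : ℝ) : EReal :=
  ⨅ p ∈ Ioi (0 : ℝ), familyError φ a b p

/-- `φ p₀` is the minimax approximant of the family on `(a,b)`: `p₀` is the unique positive
parameter at which the infimum of the errors is attained. -/
def IsMinimaxApproximant (φ : ℝ → ℝ → ℝ) (a b p₀ : ℝ) : Prop :=
  0 < p₀ ∧ familyError φ a b p₀ = minimaxError φ a b ∧
    ∀ p : ℝ, 0 < p → familyError φ a b p = minimaxError φ a b → p = p₀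

/-- `t` is the only local extremum of `f` on `(a,b)`, and `f` attains its minimum over `(a,b)`
at `t`. -/
def IsOnlyExtremumAndMin (f : ℝ → ℝ) (a b t : ℝ) : Prop :=
  t ∈ Ioo a b ∧ IsMinOn f (Ioo a b) t ∧ ∀ s ∈ Ioo a b, IsLocalExtr f s → s = t

/-- The family `φ_p(x) = -cos x + (sin x / x)³ - x⁴/15 + p x⁶`. -/
def phi (p x : ℝ) : ℝ :=
  -Real.cos x + (Real.sin x / x) ^ 3 - (1 / 15) * x ^ 4 + p * x ^ 6

/-- `A = (4π⁷ - 7680) / (15π⁹)`. -/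
def constA : ℝ := (4 * Real.pi ^ 7 - 7680) / (15 * Real.pi ^ 9)

/-- `B = 23 / 1890`. -/
def constB : ℝ := 23 / 1890

end

/-- The absolute values of the Taylor coefficients of `x⁻⁶ (cos x - (sin x / x)³ + x⁴/15)` in
powers of `x²`. -/
noncomputable def gapCoeff (n : ℕ) : ℝ :=
  (3 ^ (2 * n + 9) - 3) / (4 * (2 * n + 9).factorial) - 1 / (2 * n + 6).factorial

/-- The quotient `x⁻⁶ (cos x - (sin x / x)³ + x⁴/15)`, so that `φ_p(x) = x⁶ (p - gap x)`. -/
noncomputable def gap (x : ℝ) : ℝ :=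
  (Real.cos x - (Real.sin x / x) ^ 3 + (1 / 15) * x ^ 4) / x ^ 6

/-- The function with `φ_p'(x) = x⁵ (6 p - gapSlope x)`. -/
noncomputable def gapSlope (x : ℝ) : ℝ :=
  (-Real.sin x - 3 * (Real.sin x / x) ^ 2 * ((Real.cos x * x - Real.sin x * 1) / x ^ 2)
    + (4 / 15) * x ^ 3) / x ^ 5

section AlternatingSeries

variable {a : ℕ → ℝ} {y z u v : ℝ}

theorem antitone_mul_pow_of_five_mul_succ_le (ha : ∀ n, 0 < a n)
    (h5 : ∀ n, 5 * a (n + 1) ≤ a n) (hy : 0 ≤ y) (hy' : y ≤ 5) :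
    Antitone fun n => a n * y ^ n := by
  refine antitone_nat_of_succ_le fun n => ?_
  have h1 : a (n + 1) * y ≤ a n := by nlinarith [h5 n, ha (n + 1)]
  calc a (n + 1) * y ^ (n + 1) = a (n + 1) * y * y ^ n := by ring
    _ ≤ a n * y ^ n := by gcongr

theorem HasSum.le_partialSum_alternating {b : ℕ → ℝ} (hb : Antitone b)
    (hu : HasSum (fun n => (-1) ^ n * b n) u) (k : ℕ) :
    u ≤ ∑ i ∈ Finset.range (2 * k + 1), (-1) ^ i * b i :=
  hb.tendsto_le_alternating_series hu.tendsto_sum_nat k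

theorem HasSum.partialSum_alternating_le {b : ℕ → ℝ} (hb : Antitone b)
    (hu : HasSum (fun n => (-1) ^ n * b n) u) (k : ℕ) :
    ∑ i ∈ Finset.range (2 * k), (-1) ^ i * b i ≤ u :=
  hb.alternating_series_le_tendsto hu.tendsto_sum_nat k

theorem pow_succ_sub_pow_succ_le (n : ℕ) (hy : 0 ≤ y) (hyz : y ≤ z) :
    z ^ (n + 2) - y ^ (n + 2) ≤ 2 * z * (z ^ (n + 1) - y ^ (n + 1)) := by
  have h : y ^ n ≤ z ^ n := pow_le_pow_left₀ hy hyz n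
  have h0 : 0 ≤ y ^ n := pow_nonneg hy n
  have hz : 0 ≤ z := hy.trans hyz
  have e : 2 * z * (z ^ (n + 1) - y ^ (n + 1)) - (z ^ (n + 2) - y ^ (n + 2))
      = z ^ 2 * (z ^ n - y ^ n) + y ^ n * (z - y) ^ 2 := by ring
  have : 0 ≤ z ^ 2 * (z ^ n - y ^ n) := mul_nonneg (sq_nonneg z) (by linarith)
  have : 0 ≤ y ^ n * (z - y) ^ 2 := by positivity
  linarith

theorem HasSum.alternating_pow_lt (ha : ∀ n, 0 < a n) (h5 : ∀ n, 5 * a (n + 1) ≤ a n)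
    (hy : 0 ≤ y) (hyz : y < z) (hz : 2 * z < 5)
    (hu : HasSum (fun n => (-1) ^ n * (a n * y ^ n)) u)
    (hv : HasSum (fun n => (-1) ^ n * (a n * z ^ n)) v) : v < u := by
  have hz0 : 0 < z := hy.trans_lt hyz
  have h := (hasSum_nat_add_iff' 1).2 (hu.sub hv)
  have hs : HasSum (fun n => (-1) ^ n * (a (n + 1) * (z ^ (n + 1) - y ^ (n + 1)))) (u - v) := by
    convert! h using 1
    · funext n; ring
    · simp
  have hstep : ∀ n, a (n + 2) * (z ^ (n + 2) - y ^ (n + 2))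
      ≤ 2 * z / 5 * (a (n + 1) * (z ^ (n + 1) - y ^ (n + 1))) := by
    intro n
    have h1 := pow_succ_sub_pow_succ_le n hy hyz.le
    have h2 : y ^ (n + 1) ≤ z ^ (n + 1) := pow_le_pow_left₀ hy hyz.le _
    calc a (n + 2) * (z ^ (n + 2) - y ^ (n + 2))
        ≤ a (n + 2) * (2 * z * (z ^ (n + 1) - y ^ (n + 1))) := by
          have := ha (n + 2); gcongr
      _ = 5 * a (n + 2) * (2 * z / 5 * (z ^ (n + 1) - y ^ (n + 1))) := by ring
      _ ≤ a (n + 1) * (2 * z / 5 * (z ^ (n + 1) - y ^ (n + 1))) := by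
          have : 0 ≤ z ^ (n + 1) - y ^ (n + 1) := by linarith
          gcongr
          exact h5 (n + 1)
      _ = _ := by ring
  have hnn : ∀ n, 0 ≤ a (n + 1) * (z ^ (n + 1) - y ^ (n + 1)) := fun n =>
    mul_nonneg (ha _).le (sub_nonneg.2 (pow_le_pow_left₀ hy hyz.le _))
  have hanti : Antitone fun n => a (n + 1) * (z ^ (n + 1) - y ^ (n + 1)) :=
    antitone_nat_of_succ_le fun n => (hstep n).trans (by nlinarith [hnn n])
  have h2 := hs.partialSum_alternating_le hanti 1
  simp only [mul_one, Finset.sum_range_succ, Finset.sum_range_zero, pow_zero, pow_one,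
    one_mul] at h2
  have h3 : a 2 * (z ^ 2 - y ^ 2) ≤ 2 * z / 5 * (a 1 * (z ^ 1 - y ^ 1)) := hstep 0
  rw [pow_one, pow_one] at h3
  have h4 : 0 < a 1 * (z - y) := mul_pos (ha 1) (by linarith)
  norm_num at h2
  nlinarith

end AlternatingSeries

theorem cubic_le_three_pow (n : ℕ) :
    24 + 40 * ((2 * n + 9) * (2 * n + 8) * (2 * n + 7) : ℝ)
      ≤ 3 ^ (2 * n + 9) - 3 + 4 * ((2 * n + 11) * (2 * n + 10) * (2 * n + 9)) := by
  induction n with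
  | zero => norm_num
  | succ n ih =>
    have h : (3 : ℝ) ^ (2 * (n + 1) + 9) = 9 * 3 ^ (2 * n + 9) := by ring
    rw [h]
    push_cast
    have hn : (0 : ℝ) ≤ n := n.cast_nonneg
    nlinarith [pow_nonneg hn 2, pow_nonneg hn 3]

theorem gapCoeff_eq (n : ℕ) : gapCoeff n =
    (3 ^ (2 * n + 9) - 3 - 4 * ((2 * n + 9) * (2 * n + 8) * (2 * n + 7)))
      / (4 * (2 * n + 9).factorial) := by
  have h : ((2 * n + 9).factorial : ℝ)
      = (2 * n + 9) * (2 * n + 8) * (2 * n + 7) * (2 * n + 6).factorial := by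
    simp only [Nat.factorial_succ (2 * n + 8), Nat.factorial_succ (2 * n + 7),
      Nat.factorial_succ (2 * n + 6)]
    push_cast
    ring
  have h6 : ((2 * n + 6).factorial : ℝ) ≠ 0 := by positivity
  rw [gapCoeff, h]
  field_simp

theorem gapCoeff_pos (n : ℕ) : 0 < gapCoeff n := by
  rw [gapCoeff_eq]
  refine div_pos ?_ (by positivity)
  have := cubic_le_three_pow n
  have hn : (0 : ℝ) ≤ n := n.cast_nonneg
  nlinarith [pow_nonneg hn 2, pow_nonneg hn 3]

theorem five_mul_gapCoeff_succ_le (n : ℕ) :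
    5 * ((n + 4) * gapCoeff (n + 1)) ≤ (n + 3) * gapCoeff n := by
  have h : ((2 * (n + 1) + 9).factorial : ℝ)
      = (2 * n + 11) * (2 * n + 10) * (2 * n + 9).factorial := by
    rw [show 2 * (n + 1) + 9 = 2 * n + 9 + 1 + 1 by ring, Nat.factorial_succ, Nat.factorial_succ]
    push_cast
    ring
  have hN : (0 : ℝ) < 3 ^ (2 * n + 9) - 3 - 4 * ((2 * n + 9) * (2 * n + 8) * (2 * n + 7)) := by
    have := gapCoeff_pos n
    rw [gapCoeff_eq] at this
    by_contra hc
    exact absurd this (not_lt.2 (div_nonpos_of_nonpos_of_nonneg (not_lt.1 hc) (by positivity)))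
  have hN' : (3 : ℝ) ^ (2 * (n + 1) + 9) - 3
        - 4 * ((2 * (n + 1 : ℕ) + 9) * (2 * (n + 1 : ℕ) + 8) * (2 * (n + 1 : ℕ) + 7))
      ≤ 10 * (3 ^ (2 * n + 9) - 3 - 4 * ((2 * n + 9) * (2 * n + 8) * (2 * n + 7))) := by
    have := cubic_le_three_pow n
    rw [show (3 : ℝ) ^ (2 * (n + 1) + 9) = 9 * 3 ^ (2 * n + 9) by ring]
    push_cast
    nlinarith
  rw [gapCoeff_eq, gapCoeff_eq, h]
  set N : ℝ := 3 ^ (2 * n + 9) - 3 - 4 * ((2 * n + 9) * (2 * n + 8) * (2 * n + 7))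
  have hf : (0 : ℝ) < (2 * n + 9).factorial := by positivity
  have hn : (0 : ℝ) ≤ n := n.cast_nonneg
  calc _ ≤ 5 * (((n : ℝ) + 4) * (10 * N / (4 * ((2 * n + 11) * (2 * n + 10)
          * (2 * n + 9).factorial)))) := by gcongr
    _ = 50 * (n + 4) * N / (((2 * n + 11) * (2 * n + 10)) * (4 * (2 * n + 9).factorial)) := by
        field_simp
        ring
    _ ≤ (((n + 3) * ((2 * n + 11) * (2 * n + 10))) * N)
          / (((2 * n + 11) * (2 * n + 10)) * (4 * (2 * n + 9).factorial)) := by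
        refine div_le_div_of_nonneg_right (mul_le_mul_of_nonneg_right ?_ hN.le) (by positivity)
        nlinarith [pow_nonneg hn 2, pow_nonneg hn 3]
    _ = _ := by field_simp

theorem five_mul_gapCoeff_succ_le' (n : ℕ) : 5 * gapCoeff (n + 1) ≤ gapCoeff n := by
  have h := five_mul_gapCoeff_succ_le n
  have hn : (0 : ℝ) ≤ n := n.cast_nonneg
  have := gapCoeff_pos (n + 1)
  have h2 : ((n : ℝ) + 3) * (5 * gapCoeff (n + 1)) ≤ (n + 3) * gapCoeff n := by nlinarith
  exact le_of_mul_le_mul_left h2 (by positivity)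

theorem gapSlopeCoeff_pos (n : ℕ) : 0 < 2 * ((n : ℝ) + 3) * gapCoeff n :=
  mul_pos (by positivity) (gapCoeff_pos n)

theorem five_mul_gapSlopeCoeff_succ_le (n : ℕ) :
    5 * (2 * (((n + 1 : ℕ) : ℝ) + 3) * gapCoeff (n + 1)) ≤ 2 * ((n : ℝ) + 3) * gapCoeff n := by
  have := five_mul_gapCoeff_succ_le n
  push_cast
  linarith

theorem hasSum_gap {x : ℝ} (hx : x ≠ 0) :
    HasSum (fun n => (-1) ^ n * (gapCoeff n * (x ^ 2) ^ n)) (gap x) := by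
  have hc := ((hasSum_nat_add_iff' 3).2 (Real.hasSum_cos x)).mul_left (4 * x ^ 3)
  have hs := ((hasSum_nat_add_iff' 4).2 (Real.hasSum_sin x)).mul_left 3
  have hs3 := (hasSum_nat_add_iff' 4).2 (Real.hasSum_sin (3 * x))
  have h := ((hc.sub hs).add hs3).mul_left (1 / (4 * x ^ 9))
  convert! h using 1
  · funext n
    rw [gapCoeff]
    simp only [show 2 * (n + 3) = 2 * n + 6 by ring, show 2 * (n + 4) + 1 = 2 * n + 9 by ring]
    have h6 : ((2 * n + 6).factorial : ℝ) ≠ 0 := by positivity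
    have h9 : ((2 * n + 9).factorial : ℝ) ≠ 0 := by positivity
    field_simp
    ring
  · rw [gap, Real.sin_three_mul]
    simp only [Finset.sum_range_succ, Finset.sum_range_zero, Nat.factorial]
    push_cast
    field_simp
    ring

theorem hasSum_gapSlope {x : ℝ} (hx : x ≠ 0) :
    HasSum (fun n : ℕ => (-1) ^ n * (2 * ((n : ℝ) + 3) * gapCoeff n * (x ^ 2) ^ n))
      (gapSlope x) := by
  have hs1 := ((hasSum_nat_add_iff' 2).2 (Real.hasSum_sin x)).mul_left (-4 * x ^ 4)
  have hc := ((hasSum_nat_add_iff' 4).2 (Real.hasSum_cos x)).mul_left (-3 * x)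
  have hc3 := ((hasSum_nat_add_iff' 4).2 (Real.hasSum_cos (3 * x))).mul_left (3 * x)
  have hs := ((hasSum_nat_add_iff' 4).2 (Real.hasSum_sin x)).mul_left 9
  have hs3 := ((hasSum_nat_add_iff' 4).2 (Real.hasSum_sin (3 * x))).mul_left (-3)
  have h := ((((hs1.add hc).add hc3).add hs).add hs3).mul_left (1 / (4 * x ^ 9))
  convert! h using 1
  · funext n
    rw [gapCoeff]
    simp only [show 2 * (n + 2) + 1 = 2 * n + 5 by ring, show 2 * (n + 4) = 2 * n + 8 by ring]
    have e9 : ((2 * n + 9).factorial : ℝ) = (2 * n + 9) * (2 * n + 8).factorial := by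
      rw [Nat.factorial_succ (2 * n + 8)]; push_cast; ring
    have e8 : ((2 * n + 8).factorial : ℝ)
        = (2 * n + 8) * (2 * n + 7) * (2 * n + 6) * (2 * n + 5).factorial := by
      rw [Nat.factorial_succ (2 * n + 7), Nat.factorial_succ (2 * n + 6),
        Nat.factorial_succ (2 * n + 5)]; push_cast; ring
    have e6 : ((2 * n + 6).factorial : ℝ) = (2 * n + 6) * (2 * n + 5).factorial := by
      rw [Nat.factorial_succ (2 * n + 5)]; push_cast; ring
    have h5 : ((2 * n + 5).factorial : ℝ) ≠ 0 := by positivity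
    simp only [e9, e8, e6]
    field_simp
    ring
  · rw [gapSlope, Real.sin_three_mul, Real.cos_three_mul]
    simp only [Finset.sum_range_succ, Finset.sum_range_zero, Nat.factorial]
    push_cast
    field_simp
    rw [Real.cos_sq']
    ring

theorem antitone_gapCoeff_mul_pow {y : ℝ} (hy : 0 ≤ y) (hy' : y ≤ 5) :
    Antitone fun n => gapCoeff n * y ^ n :=
  antitone_mul_pow_of_five_mul_succ_le gapCoeff_pos five_mul_gapCoeff_succ_le' hy hy'

theorem two_mul_sq_lt_five {x : ℝ} (hx : 0 < x) (hx' : x ≤ Real.pi / 2) : 2 * x ^ 2 < 5 := by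
  nlinarith [Real.pi_lt_d4]

theorem gap_strictAntiOn : StrictAntiOn gap (Ioc 0 (Real.pi / 2)) := fun x hx _ hy hxy =>
  HasSum.alternating_pow_lt gapCoeff_pos five_mul_gapCoeff_succ_le' (sq_nonneg x)
    (pow_lt_pow_left₀ hxy hx.1.le two_ne_zero) (two_mul_sq_lt_five hy.1 hy.2)
    (hasSum_gap hx.1.ne') (hasSum_gap hy.1.ne')

theorem gapSlope_strictAntiOn : StrictAntiOn gapSlope (Ioc 0 (Real.pi / 2)) := fun x hx _ hy hxy =>
  HasSum.alternating_pow_lt gapSlopeCoeff_pos five_mul_gapSlopeCoeff_succ_le (sq_nonneg x)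
    (pow_lt_pow_left₀ hxy hx.1.le two_ne_zero) (two_mul_sq_lt_five hy.1 hy.2)
    (hasSum_gapSlope hx.1.ne') (hasSum_gapSlope hy.1.ne')

theorem gap_le_partialSum {x : ℝ} (hx : 0 < x) (hx' : x ≤ Real.pi / 2) (k : ℕ) :
    gap x ≤ ∑ i ∈ Finset.range (2 * k + 1), (-1) ^ i * (gapCoeff i * (x ^ 2) ^ i) :=
  (hasSum_gap hx.ne').le_partialSum_alternating
    (antitone_gapCoeff_mul_pow (sq_nonneg x) (by linarith [two_mul_sq_lt_five hx hx'])) k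

theorem partialSum_le_gap {x : ℝ} (hx : 0 < x) (hx' : x ≤ Real.pi / 2) (k : ℕ) :
    ∑ i ∈ Finset.range (2 * k), (-1) ^ i * (gapCoeff i * (x ^ 2) ^ i) ≤ gap x :=
  (hasSum_gap hx.ne').partialSum_alternating_le
    (antitone_gapCoeff_mul_pow (sq_nonneg x) (by linarith [two_mul_sq_lt_five hx hx'])) k

theorem antitone_gapSlopeCoeff_mul_pow {y : ℝ} (hy : 0 ≤ y) (hy' : y ≤ 5) :
    Antitone fun n : ℕ => 2 * ((n : ℝ) + 3) * gapCoeff n * y ^ n :=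
  antitone_mul_pow_of_five_mul_succ_le (a := fun n : ℕ => 2 * ((n : ℝ) + 3) * gapCoeff n)
    gapSlopeCoeff_pos five_mul_gapSlopeCoeff_succ_le hy hy'

theorem gapSlope_le_partialSum {x : ℝ} (hx : 0 < x) (hx' : x ≤ Real.pi / 2) (k : ℕ) :
    gapSlope x ≤ ∑ i ∈ Finset.range (2 * k + 1),
      (-1) ^ i * (2 * ((i : ℝ) + 3) * gapCoeff i * (x ^ 2) ^ i) :=
  (hasSum_gapSlope hx.ne').le_partialSum_alternating
    (antitone_gapSlopeCoeff_mul_pow (sq_nonneg x) (by linarith [two_mul_sq_lt_five hx hx'])) k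

theorem partialSum_le_gapSlope {x : ℝ} (hx : 0 < x) (hx' : x ≤ Real.pi / 2) (k : ℕ) :
    ∑ i ∈ Finset.range (2 * k), (-1) ^ i * (2 * ((i : ℝ) + 3) * gapCoeff i * (x ^ 2) ^ i)
      ≤ gapSlope x :=
  (hasSum_gapSlope hx.ne').partialSum_alternating_le
    (antitone_gapSlopeCoeff_mul_pow (sq_nonneg x) (by linarith [two_mul_sq_lt_five hx hx'])) k

theorem phi_eq_mul_sub_gap (p : ℝ) {x : ℝ} (hx : x ≠ 0) : phi p x = x ^ 6 * (p - gap x) := by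
  rw [phi, gap]
  field_simp
  ring

theorem hasDerivAt_phi (p : ℝ) {x : ℝ} (hx : x ≠ 0) :
    HasDerivAt (phi p) (x ^ 5 * (6 * p - gapSlope x)) x := by
  have h := (((Real.hasDerivAt_cos x).neg.add
    ((((Real.hasDerivAt_sin x).div (hasDerivAt_id x) hx)).pow 3)).sub
      ((hasDerivAt_pow 4 x).const_mul (1 / 15))).add ((hasDerivAt_pow 6 x).const_mul p)
  refine h.congr_deriv ?_
  rw [gapSlope]
  simp only [id, Pi.div_apply]
  push_cast
  field_simp
  ring

theorem continuousOn_gapSlope : ContinuousOn gapSlope (Ioi 0) := by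
  unfold gapSlope
  have hne : ∀ x ∈ Ioi (0 : ℝ), x ≠ 0 := fun x hx => ne_of_gt hx
  have hne' : ∀ k : ℕ, ∀ x ∈ Ioi (0 : ℝ), x ^ k ≠ 0 := fun k x hx => pow_ne_zero k (hne x hx)
  have h1 : ContinuousOn (fun x : ℝ => Real.sin x / x) (Ioi 0) :=
    Real.continuousOn_sin.div continuousOn_id hne
  have h2 : ContinuousOn
      (fun x : ℝ => (Real.cos x * x - Real.sin x * 1) / x ^ 2) (Ioi 0) :=
    ContinuousOn.div (by fun_prop) (by fun_prop) (hne' 2)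
  exact ContinuousOn.div (by fun_prop) (by fun_prop) (hne' 5)

theorem gap_pi_div_two : gap (Real.pi / 2) = constA := by
  have := Real.pi_ne_zero
  rw [gap, constA, Real.cos_pi_div_two, Real.sin_pi_div_two]
  field_simp
  ring

theorem phi_pi_div_two (p : ℝ) : phi p (Real.pi / 2) = (Real.pi / 2) ^ 6 * (p - constA) := by
  rw [phi_eq_mul_sub_gap p (by positivity), gap_pi_div_two]

theorem gapCoeff_zero : gapCoeff 0 = constB := by
  norm_num [gapCoeff, constB, Nat.factorial]

theorem gapCoeff_one : gapCoeff 1 = 41 / 37800 := by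
  norm_num [gapCoeff, Nat.factorial]

theorem gapCoeff_two : gapCoeff 2 = 53 / 831600 := by
  norm_num [gapCoeff, Nat.factorial]

theorem gapSlope_pi_div_two_lt : gapSlope (Real.pi / 2) < 6 * constA := by
  have hpi : 0 < Real.pi / 2 := by positivity
  have h1 := gapSlope_le_partialSum hpi le_rfl 1
  have h2 := partialSum_le_gap hpi le_rfl 1
  rw [gap_pi_div_two] at h2
  norm_num [Finset.sum_range_succ] at h1 h2
  rw [gapCoeff_one, gapCoeff_two] at h1
  rw [gapCoeff_one] at h2
  have h3 := two_mul_sq_lt_five hpi le_rfl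
  have h4 : 0 < (Real.pi / 2) ^ 2 := by positivity
  nlinarith

theorem sub_mul_le_gap {x : ℝ} (hx : 0 < x) (hx' : x ≤ Real.pi / 2) :
    constB - 41 / 37800 * x ^ 2 ≤ gap x := by
  have h := partialSum_le_gap hx hx' 1
  norm_num [Finset.sum_range_succ, gapCoeff_zero, gapCoeff_one] at h
  linarith

theorem sub_mul_le_gapSlope {x : ℝ} (hx : 0 < x) (hx' : x ≤ Real.pi / 2) :
    6 * constB - 8 * (41 / 37800) * x ^ 2 ≤ gapSlope x := by
  have h := partialSum_le_gapSlope hx hx' 1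
  norm_num [Finset.sum_range_succ, gapCoeff_zero, gapCoeff_one] at h
  linarith

theorem constA_pos : 0 < constA := by
  have h := Real.pi_gt_three
  have h7 : (3 : ℝ) ^ 7 < Real.pi ^ 7 := pow_lt_pow_left₀ h (by norm_num) (by norm_num)
  exact div_pos (by linarith) (by positivity)

section Member

variable {p : ℝ}

theorem exists_phi_neg (hp : p ∈ Ioo constA constB) :
    ∃ x ∈ Ioo 0 (Real.pi / 2), phi p x < 0 ∧ 6 * p < gapSlope x := by
  have hA := constA_pos
  have hB : constB < 1 := by norm_num [constB]
  have h3 := Real.pi_gt_three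
  have hx : 0 < constB - p := sub_pos.2 hp.2
  have hx1 : constB - p < 1 := by linarith [hp.1]
  have hx2 : (constB - p) ^ 2 < constB - p := by nlinarith
  refine ⟨constB - p, ⟨hx, by linarith⟩, ?_, ?_⟩
  · rw [phi_eq_mul_sub_gap p hx.ne']
    have := sub_mul_le_gap hx (by linarith)
    exact mul_neg_of_pos_of_neg (by positivity) (by linarith)
  · have := sub_mul_le_gapSlope hx (by linarith)
    linarith

theorem exists_gapSlope_eq (hp : p ∈ Ioo constA constB) :
    ∃ t ∈ Ioo 0 (Real.pi / 2), gapSlope t = 6 * p := by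
  obtain ⟨x, hx, -, hs⟩ := exists_phi_neg hp
  have hc : ContinuousOn gapSlope (Icc x (Real.pi / 2)) :=
    continuousOn_gapSlope.mono fun y hy => hx.1.trans_le hy.1
  obtain ⟨t, ht, hte⟩ := intermediate_value_Ioo' hx.2.le hc
    ⟨gapSlope_pi_div_two_lt.trans (by linarith [hp.1] : 6 * constA < 6 * p), hs⟩
  exact ⟨t, ⟨hx.1.trans ht.1, ht.2⟩, hte⟩

theorem isOnlyExtremumAndMin_of_gapSlope_eq {t : ℝ} (ht : t ∈ Ioo 0 (Real.pi / 2))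
    (hte : gapSlope t = 6 * p) : IsOnlyExtremumAndMin (phi p) 0 (Real.pi / 2) t := by
  have hcont : ∀ s : Set ℝ, (∀ x ∈ s, 0 < x) → ContinuousOn (phi p) s := fun s hs x hx =>
    (hasDerivAt_phi p (hs x hx).ne').continuousAt.continuousWithinAt
  have htm : t ∈ Ioc 0 (Real.pi / 2) := ⟨ht.1, ht.2.le⟩
  have hanti : StrictAntiOn (phi p) (Ioc 0 t) := by
    refine strictAntiOn_of_deriv_neg (convex_Ioc _ _) (hcont _ fun x hx => hx.1) fun x hx => ?_
    rw [interior_Ioc] at hx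
    rw [(hasDerivAt_phi p hx.1.ne').deriv]
    have := gapSlope_strictAntiOn ⟨hx.1, (hx.2.trans ht.2).le⟩ htm hx.2
    have hx0 := hx.1
    exact mul_neg_of_pos_of_neg (by positivity) (by linarith)
  have hmono : StrictMonoOn (phi p) (Ico t (Real.pi / 2)) := by
    refine strictMonoOn_of_deriv_pos (convex_Ico _ _)
      (hcont _ fun x hx => ht.1.trans_le hx.1) fun x hx => ?_
    rw [interior_Ico] at hx
    have hx0 : 0 < x := ht.1.trans hx.1
    rw [(hasDerivAt_phi p hx0.ne').deriv]
    have := gapSlope_strictAntiOn htm ⟨hx0, hx.2.le⟩ hx.1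
    exact mul_pos (by positivity) (by linarith)
  refine ⟨ht, fun x hx => ?_, fun s hs hext => ?_⟩
  · rcases le_total x t with h | h
    · exact hanti.antitoneOn ⟨hx.1, h⟩ ⟨ht.1, le_rfl⟩ h
    · exact hmono.monotoneOn ⟨le_rfl, ht.2⟩ ⟨h, hx.2⟩ h
  · have h0 := hext.hasDerivAt_eq_zero (hasDerivAt_phi p hs.1.ne')
    have h1 := (mul_eq_zero.1 h0).resolve_left (pow_ne_zero 5 hs.1.ne')
    exact gapSlope_strictAntiOn.injOn ⟨hs.1, hs.2.le⟩ htm (by linarith)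

theorem phi_le_phi_pi_div_two (hp : constA ≤ p) {x : ℝ} (hx : x ∈ Ioo 0 (Real.pi / 2)) :
    phi p x ≤ phi p (Real.pi / 2) := by
  rw [phi_pi_div_two, phi_eq_mul_sub_gap p hx.1.ne']
  have h := gap_strictAntiOn ⟨hx.1, hx.2.le⟩ ⟨by positivity, le_rfl⟩ hx.2
  rw [gap_pi_div_two] at h
  have h1 := pow_le_pow_left₀ hx.1.le hx.2.le 6
  have hx0 := hx.1
  calc x ^ 6 * (p - gap x) ≤ x ^ 6 * (p - constA) := by gcongr
    _ ≤ _ := by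
      have : 0 ≤ p - constA := by linarith
      gcongr

theorem tendsto_phi_pi_div_two (p : ℝ) :
    Tendsto (phi p) (𝓝[<] (Real.pi / 2)) (𝓝 (phi p (Real.pi / 2))) :=
  (hasDerivAt_phi p (by positivity)).continuousAt.continuousWithinAt

end Member

theorem phi_sub_phi (p q x : ℝ) : phi p x - phi q x = (p - q) * x ^ 6 := by
  simp only [phi]
  ring

theorem phi_lt_phi {p q x : ℝ} (hpq : p < q) (hx : 0 < x) : phi p x < phi q x := by
  have := phi_sub_phi q p x
  have : 0 < (q - p) * x ^ 6 := mul_pos (sub_pos.2 hpq) (by positivity)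
  linarith

section FamilyError

variable {φ : ℝ → ℝ → ℝ} {a b p c : ℝ}

theorem abs_le_familyError {x : ℝ} (hx : x ∈ Ioo a b) :
    ((|φ p x| : ℝ) : EReal) ≤ familyError φ a b p :=
  le_iSup₂ (f := fun x (_ : x ∈ Ioo a b) => ((|φ p x| : ℝ) : EReal)) x hx

theorem le_familyError_of_tendsto (hab : a < b) (h : Tendsto (φ p) (𝓝[<] b) (𝓝 c)) :
    (c : EReal) ≤ familyError φ a b p := by
  have h1 : Tendsto (fun x => ((|φ p x| : ℝ) : EReal)) (𝓝[<] b) (𝓝 ((|c| : ℝ) : EReal)) :=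
    (continuous_coe_real_ereal.tendsto _).comp h.abs
  have h2 : ((|c| : ℝ) : EReal) ≤ familyError φ a b p := by
    refine le_of_tendsto h1 ?_
    filter_upwards [Ioo_mem_nhdsLT hab] with x hx using abs_le_familyError hx
  exact le_trans (EReal.coe_le_coe_iff.2 (le_abs_self c)) h2

theorem familyError_le (h : ∀ x ∈ Ioo a b, |φ p x| ≤ c) : familyError φ a b p ≤ c :=
  iSup₂_le fun x hx => EReal.coe_le_coe_iff.2 (h x hx)

/-- A parameter whose error is strictly smaller than that of every other positive parameter is the
minimax parameter. -/
theorem isMinimaxApproximant_of_forall_lt (hp : 0 < p) (hc : familyError φ a b p = c)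
    (h : ∀ q, 0 < q → q ≠ p → (c : EReal) < familyError φ a b q) :
    (c : EReal) = minimaxError φ a b ∧ IsMinimaxApproximant φ a b p := by
  have hmin : (c : EReal) = minimaxError φ a b := by
    refine le_antisymm (le_iInf₂ fun q hq => ?_) (hc ▸ iInf₂_le p hp)
    rcases eq_or_ne q p with rfl | hne
    · exact hc.ge
    · exact (h q hq hne).le
  refine ⟨hmin, hp, hc.trans hmin, fun q hq hqe => ?_⟩
  by_contra hne
  exact (h q hq hne).ne (hmin.trans hqe.symm)

end FamilyError

section Numerics

theorem pi_div_two_sq_lt : (Real.pi / 2) ^ 2 < 2.4675 := by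
  nlinarith [Real.pi_lt_d6, Real.pi_gt_three]

theorem phi_pi_div_two_eq (p : ℝ) : phi p (Real.pi / 2)
    = 8 * (1 / Real.pi) ^ 3 - Real.pi ^ 4 / 240 + p * Real.pi ^ 6 / 64 := by
  have := Real.pi_ne_zero
  rw [phi, Real.cos_pi_div_two, Real.sin_pi_div_two]
  field_simp
  ring

theorem one_div_pi_cube_mem :
    (1 / Real.pi) ^ 3 ∈ Ioo (0.0322515344331 : ℝ) 0.0322515344333 := by
  have hl : (0.3183098861837 : ℝ) < 1 / Real.pi := by
    rw [lt_div_iff₀ Real.pi_pos]; nlinarith [Real.pi_lt_d20]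
  have hu : 1 / Real.pi < (0.3183098861838 : ℝ) := by
    rw [div_lt_iff₀ Real.pi_pos]; nlinarith [Real.pi_gt_d20]
  exact ⟨lt_trans (by norm_num) (pow_lt_pow_left₀ hl (by norm_num) three_ne_zero),
    lt_trans (pow_lt_pow_left₀ hu (by positivity) three_ne_zero) (by norm_num)⟩

theorem pi_pow_four_mem : Real.pi ^ 4 ∈ Ioo (97.4090910340 : ℝ) 97.4090910341 :=
  ⟨lt_trans (by norm_num) (pow_lt_pow_left₀ Real.pi_gt_d20 (by norm_num) four_ne_zero),
    lt_trans (pow_lt_pow_left₀ Real.pi_lt_d20 (by positivity) four_ne_zero) (by norm_num)⟩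

theorem pi_pow_six_mem : Real.pi ^ 6 ∈ Ioo (961.3891935752 : ℝ) 961.3891935754 :=
  ⟨lt_trans (by norm_num) (pow_lt_pow_left₀ Real.pi_gt_d20 (by norm_num) (by norm_num)),
    lt_trans (pow_lt_pow_left₀ Real.pi_lt_d20 (by positivity) (by norm_num)) (by norm_num)⟩

theorem phi_lower_pi_div_two_mem :
    phi 0.01000418 (Real.pi / 2) ∈ Ioo (0.002420915 : ℝ) 0.0024209155 := by
  have h3 := one_div_pi_cube_mem
  have h4 := pi_pow_four_mem
  have h6 := pi_pow_six_mem
  rw [phi_pi_div_two_eq]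
  constructor <;> linarith [h3.1, h3.2, h4.1, h4.2, h6.1, h6.2]

theorem phi_upper_pi_div_two_mem :
    phi 0.010004185 (Real.pi / 2) ∈ Ioo (0.00242099 : ℝ) 0.0024209905 := by
  have h3 := one_div_pi_cube_mem
  have h4 := pi_pow_four_mem
  have h6 := pi_pow_six_mem
  rw [phi_pi_div_two_eq]
  constructor <;> linarith [h3.1, h3.2, h4.1, h4.2, h6.1, h6.2]

theorem phi_lower_lt : phi 0.01000418 1.29986 < -0.00242096 := by
  have h := partialSum_le_gap (x := 1.29986) (by norm_num) (by linarith [Real.pi_gt_three]) 3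
  have h2 : (0.01050607 : ℝ) ≤
      ∑ i ∈ Finset.range (2 * 3), (-1) ^ i * (gapCoeff i * ((1.29986 : ℝ) ^ 2) ^ i) := by
    norm_num [Finset.sum_range_succ, gapCoeff, Nat.factorial]
  rw [phi_eq_mul_sub_gap _ (by norm_num)]
  nlinarith

theorem neg_lt_sextic_mul_sub {y : ℝ} (hy : 0 ≤ y) (hy' : y ≤ 2.4675) :
    -0.00242098 < y ^ 3 * (0.010004185 - (0.01216931217 - 0.001084656084 * y
      + 0.000063732564 * y ^ 2 - 0.000002741122 * y ^ 3 + 0.000000090757 * y ^ 4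
      - 0.000000002388 * y ^ 5 + 0.000000000052 * y ^ 6)) := by
  have hR : 0 ≤ 0.00084799456386848428592233561712755974194855936
      + 0.001003762346732411285876729839005415325696 * y
      + y ^ 2 * (0.0008911045270469460252983292327206912
        - 0.0000552028900583088547894934016 * y)
      + y ^ 4 * (0.000002453877734398897128448 - 0.0000000831326411594176 * y)
      + y ^ 6 * (0.00000000221227744 - 0.000000000052 * y) := by
    have h1 : 0 ≤ 0.0008911045270469460252983292327206912
        - 0.0000552028900583088547894934016 * y := by linarith
    have h2 : 0 ≤ 0.000002453877734398897128448 - 0.0000000831326411594176 * y := by linarith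
    have h3 : 0 ≤ 0.00000000221227744 - 0.000000000052 * y := by linarith
    positivity
  have h := mul_nonneg (sq_nonneg (y - 1.68964)) hR
  linarith

theorem neg_lt_phi_upper {x : ℝ} (hx : x ∈ Ioo 0 (Real.pi / 2)) :
    -0.00242098 < phi 0.010004185 x := by
  have hy : x ^ 2 ≤ 2.4675 :=
    (pow_le_pow_left₀ hx.1.le hx.2.le 2).trans pi_div_two_sq_lt.le
  have h0 : 0 ≤ x ^ 2 := sq_nonneg x
  have h1 : gap x ≤ 0.01216931217 - 0.001084656084 * x ^ 2
      + 0.000063732564 * (x ^ 2) ^ 2 - 0.000002741122 * (x ^ 2) ^ 3 + 0.000000090757 * (x ^ 2) ^ 4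
      - 0.000000002388 * (x ^ 2) ^ 5 + 0.000000000052 * (x ^ 2) ^ 6 := by
    have h := gap_le_partialSum hx.1 hx.2.le 3
    norm_num [Finset.sum_range_succ, gapCoeff, Nat.factorial] at h
    have hk : ∀ k : ℕ, 0 ≤ (x ^ 2) ^ k := fun k => pow_nonneg h0 k
    linarith [hk 2, hk 3, hk 4, hk 5, hk 6]
  refine (neg_lt_sextic_mul_sub h0 hy).trans_le ?_
  rw [phi_eq_mul_sub_gap _ hx.1.ne', ← pow_mul]
  exact mul_le_mul_of_nonneg_left (by linarith) (pow_nonneg hx.1.le _)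

end Numerics

theorem exists_isOnlyExtremumAndMin :
    ∃ t : ℝ → ℝ, ∀ p ∈ Ioo constA constB,
      IsOnlyExtremumAndMin (phi p) 0 (Real.pi / 2) (t p) := by
  have h : ∀ p, ∃ t, p ∈ Ioo constA constB →
      IsOnlyExtremumAndMin (phi p) 0 (Real.pi / 2) t := by
    intro p
    by_cases hp : p ∈ Ioo constA constB
    · obtain ⟨t, ht, hte⟩ := exists_gapSlope_eq hp
      exact ⟨t, fun _ => isOnlyExtremumAndMin_of_gapSlope_eq ht hte⟩
    · exact ⟨0, fun h => absurd h hp⟩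
  choose t ht using h
  exact ⟨t, ht⟩

section Minimum

variable {t : ℝ → ℝ} {p q : ℝ}

theorem phi_min_neg (ht : IsOnlyExtremumAndMin (phi p) 0 (Real.pi / 2) (t p))
    (hp : p ∈ Ioo constA constB) : phi p (t p) < 0 := by
  obtain ⟨x, hx, hneg, -⟩ := exists_phi_neg hp
  exact (ht.2.1 hx).trans_lt hneg

theorem phi_min_sub_le (htp : IsOnlyExtremumAndMin (phi p) 0 (Real.pi / 2) (t p))
    (htq : IsOnlyExtremumAndMin (phi q) 0 (Real.pi / 2) (t q)) :
    phi p (t p) - phi q (t q) ≤ 16 * |p - q| := by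
  have h1 : phi p (t p) ≤ phi p (t q) := htp.2.1 htq.1
  have h2 := phi_sub_phi p q (t q)
  have h0 := htq.1.1
  have h3 : (t q) ^ 6 ≤ 16 := by
    have h4 : (t q) ^ 2 ≤ 2.4675 :=
      (pow_le_pow_left₀ h0.le htq.1.2.le 2).trans pi_div_two_sq_lt.le
    calc (t q) ^ 6 = ((t q) ^ 2) ^ 3 := by ring
      _ ≤ 2.4675 ^ 3 := by gcongr
      _ ≤ 16 := by norm_num
  have h5 : (p - q) * (t q) ^ 6 ≤ |p - q| * 16 := by
    calc (p - q) * (t q) ^ 6 ≤ |p - q| * (t q) ^ 6 := by gcongr; exact le_abs_self _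
      _ ≤ _ := by gcongr
  linarith

theorem continuousOn_phi_min
    (ht : ∀ p ∈ Ioo constA constB, IsOnlyExtremumAndMin (phi p) 0 (Real.pi / 2) (t p)) :
    ContinuousOn (fun p => phi p (t p)) (Ioo constA constB) := by
  refine (LipschitzOnWith.of_dist_le_mul (K := 16) fun p hp q hq => ?_).continuousOn
  rw [Real.dist_eq, Real.dist_eq, abs_le]
  have h1 := phi_min_sub_le (ht p hp) (ht q hq)
  have h2 := phi_min_sub_le (ht q hq) (ht p hp)
  rw [abs_sub_comm q p] at h2
  push_cast
  constructor <;> linarith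

theorem phi_min_lt_phi_min (htp : IsOnlyExtremumAndMin (phi p) 0 (Real.pi / 2) (t p))
    (htq : IsOnlyExtremumAndMin (phi q) 0 (Real.pi / 2) (t q)) (hpq : p < q) :
    phi p (t p) < phi q (t q) :=
  (htp.2.1 htq.1 : phi p (t p) ≤ phi p (t q)).trans_lt (phi_lt_phi hpq htq.1.1)

end Minimum

theorem lower_mem_Ioo : (0.01000418 : ℝ) ∈ Ioo constA constB := by
  have h := phi_lower_pi_div_two_mem.1
  rw [phi_pi_div_two] at h
  have h1 : 0 < (0.01000418 : ℝ) - constA :=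
    pos_of_mul_pos_right (lt_trans (by norm_num) h) (by positivity)
  exact ⟨by linarith, by norm_num [constB]⟩

theorem upper_mem_Ioo : (0.010004185 : ℝ) ∈ Ioo constA constB :=
  ⟨lower_mem_Ioo.1.trans (by norm_num), by norm_num [constB]⟩

theorem exists_neg_phi_min_eq {t : ℝ → ℝ}
    (ht : ∀ p ∈ Ioo constA constB, IsOnlyExtremumAndMin (phi p) 0 (Real.pi / 2) (t p)) :
    ∃ p ∈ Icc (0.01000418 : ℝ) 0.010004185, -phi p (t p) = phi p (Real.pi / 2) := by
  have hsub : Icc (0.01000418 : ℝ) 0.010004185 ⊆ Ioo constA constB := fun p hp =>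
    ⟨lower_mem_Ioo.1.trans_le hp.1, hp.2.trans_lt upper_mem_Ioo.2⟩
  have hc : ContinuousOn (fun p => phi p (t p) + phi p (Real.pi / 2))
      (Icc (0.01000418 : ℝ) 0.010004185) := by
    refine ((continuousOn_phi_min ht).mono hsub).add ?_
    unfold phi
    fun_prop
  have hl : phi 0.01000418 (t 0.01000418) + phi 0.01000418 (Real.pi / 2) < 0 := by
    have h1 : phi 0.01000418 (t 0.01000418) ≤ phi 0.01000418 1.29986 :=
      (ht _ lower_mem_Ioo).2.1 ⟨by norm_num, by linarith [Real.pi_gt_three]⟩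
    linarith [phi_lower_lt, phi_lower_pi_div_two_mem.2]
  have hu : 0 < phi 0.010004185 (t 0.010004185) + phi 0.010004185 (Real.pi / 2) := by
    linarith [neg_lt_phi_upper (ht _ upper_mem_Ioo).1, phi_upper_pi_div_two_mem.1]
  obtain ⟨p, hp, hpe⟩ := intermediate_value_Icc (by norm_num) hc ⟨hl.le, hu.le⟩
  exact ⟨p, hp, by simp only at hpe; linarith⟩

theorem mainTheorem7 :
    ∃ t e : ℝ → ℝ,
      -- `t p` is the point `t^(p)` and `e p` is the left limit `φ_p(π/2−)`
      (∀ p ∈ Ioo constA constB,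
        IsOnlyExtremumAndMin (phi p) 0 (Real.pi / 2) (t p) ∧
        Tendsto (phi p) (𝓝[<] (Real.pi / 2)) (𝓝 (e p))) ∧
      ∃ p₀ ∈ Ioo constA constB,
        |phi p₀ (t p₀)| = e p₀ ∧
        (∀ p ∈ Ioo constA constB, |phi p (t p)| = e p → p = p₀) ∧
        (0.010004 ≤ p₀ ∧ p₀ < 0.010005) ∧
        (0.0024209 ≤ e p₀ ∧ e p₀ < 0.0024210) ∧
        ((e p₀ : ℝ) : EReal) = minimaxError phi 0 (Real.pi / 2) ∧
        IsMinimaxApproximant phi 0 (Real.pi / 2) p₀ ∧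
        (∀ x ∈ Ioo 0 (Real.pi / 2),
          |(Real.cos x - (Real.sin x / x) ^ 3) - (-(1 / 15) * x ^ 4 + p₀ * x ^ 6)| ≤ e p₀) := by
  obtain ⟨t, ht⟩ := exists_isOnlyExtremumAndMin
  have hpi : 0 < Real.pi / 2 := by positivity
  obtain ⟨p₀, hp₀, heq⟩ := exists_neg_phi_min_eq ht
  have hmem : p₀ ∈ Ioo constA constB :=
    ⟨lower_mem_Ioo.1.trans_le hp₀.1, hp₀.2.trans_lt upper_mem_Ioo.2⟩
  have habs : ∀ p ∈ Ioo constA constB, |phi p (t p)| = -phi p (t p) := fun p hp =>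
    abs_of_neg (phi_min_neg (ht p hp) hp)
  have hmono : StrictMono fun p => phi p (Real.pi / 2) := fun p q hpq => phi_lt_phi hpq hpi
  have hle : ∀ x ∈ Ioo 0 (Real.pi / 2), |phi p₀ x| ≤ phi p₀ (Real.pi / 2) := fun x hx => by
    have h1 : phi p₀ (t p₀) ≤ phi p₀ x := (ht p₀ hmem).2.1 hx
    exact abs_le.2 ⟨by linarith, phi_le_phi_pi_div_two hmem.1.le hx⟩
  have herr : familyError phi 0 (Real.pi / 2) p₀ = (phi p₀ (Real.pi / 2) : ℝ) :=
    (familyError_le hle).antisymm (le_familyError_of_tendsto hpi (tendsto_phi_pi_div_two p₀))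
  have hlt : ∀ q, 0 < q → q ≠ p₀ →
      ((phi p₀ (Real.pi / 2) : ℝ) : EReal) < familyError phi 0 (Real.pi / 2) q := by
    intro q _ hne
    rcases hne.lt_or_gt with h | h
    · refine lt_of_lt_of_le (EReal.coe_lt_coe_iff.2 ?_) (abs_le_familyError (ht p₀ hmem).1)
      have h1 := phi_lt_phi h (ht p₀ hmem).1.1
      have h2 := neg_abs_le (phi q (t p₀))
      linarith
    · exact (EReal.coe_lt_coe_iff.2 (hmono h)).trans_le
        (le_familyError_of_tendsto hpi (tendsto_phi_pi_div_two q))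
  obtain ⟨hmin, happ⟩ :=
    isMinimaxApproximant_of_forall_lt (constA_pos.trans hmem.1) herr hlt
  refine ⟨t, fun p => phi p (Real.pi / 2), fun p hp => ⟨ht p hp, tendsto_phi_pi_div_two p⟩,
    p₀, hmem, (habs p₀ hmem).trans heq, fun p hp hpe => ?_, ⟨?_, ?_⟩, ⟨?_, ?_⟩, hmin, happ,
    fun x hx => ?_⟩
  · rw [habs p hp] at hpe
    rcases lt_trichotomy p p₀ with h | h | h
    · have h1 := phi_min_lt_phi_min (ht p hp) (ht p₀ hmem) h
      have h2 := hmono h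
      simp only at h2
      linarith
    · exact h
    · have h1 := phi_min_lt_phi_min (ht p₀ hmem) (ht p hp) h
      have h2 := hmono h
      simp only at h2
      linarith
  · exact le_trans (by norm_num) hp₀.1
  · exact hp₀.2.trans_lt (by norm_num)
  · have h := hmono.monotone hp₀.1
    exact le_trans (by norm_num) (phi_lower_pi_div_two_mem.1.le.trans h)
  · have h := hmono.monotone hp₀.2
    exact (h.trans_lt phi_upper_pi_div_two_mem.2).trans (by norm_num)
  · have h := hle x hx
    rw [← abs_neg] at h
    convert h using 2
    rw [phi]
    ring
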